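/- Let $E$ be a rearrangement invariant (r.i.) space on $[0,1]$, that is, a Banach space of (classes of) real measurable functions on $[0,1]$ such that $g\in E$ and $f^*\le g^*$ imply $f\in E$ and $\|f\|_E\le\|g\|_E$, where $f^*$ denotes the decreasing rearrangement of $|f|$; assume also $1\in E$ and $\|1\|_E=1$. Let $n\ge 1$ and let $\ell$ be a bijection of the symmetric group $S_n$ onto $\{1,\dots,n!\}$. For a real $n\times n$ matrix $x=(x_{ij})$ let $x_1^*\ge x_2^*\ge\dots\ge x_{n^2}^*$ be the rearrangement of the numbers $|x_{ij}|$ in decreasing order, and put $$Ux(t)=\sum_{k=1}^n x_k^*\,\chi_{((k-1)/n,\,k/n)}(t),\qquad T_qx(t)=\Big(\sum_{i=1}^n|x_{i,\pi(i)}|^q\Big)^{1/q}\quad\text{for } t\in\Big[\tfrac{\ell(\pi)-1}{n!},\tfrac{\ell(\pi)}{n!}\Big),\ \pi\in S_n .$$ Let $C>1$ and $1<q<\infty$. If $\|T_qy\|_E\le C\,\|Uy\|_E$ for every diagonal $n\times n$ matrix $y$, then $$\|T_qx\|_E\le 7C\left(\|Ux\|_E+\Big(\frac1n\sum_{k=n+1}^{n^2}(x_k^*)^q\Big)^{1/q}\right)$$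 for every $n\times n$ matrix $x$. -/

import Mathlib

open MeasureTheory

noncomputable section

/-- Lebesgue measure on `[0,1]`, viewed as a measure on `ℝ`. -/
abbrev unitMeasure : Measure ℝ := volume.restrict (Set.Icc (0 : ℝ) 1)

/-- (Classes of a.e. equal) real measurable functions on `[0,1]`. -/
abbrev UnitFun : Type := ℝ →ₘ[unitMeasure] ℝ

/-- The decreasing rearrangement `f^*(t) = inf {s ≥ 0 : |{u : |f u| > s}| ≤ t}`, used for
`0 < t < 1` only (there the set is nonempty). -/
def decRearr (f : UnitFun) (t : ℝ) : ℝ :=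
  sInf {s : ℝ | 0 ≤ s ∧ unitMeasure {u : ℝ | s < |f u|} ≤ ENNReal.ofReal t}

/-- A rearrangement invariant Banach space on `[0,1]`, normalized by `‖1‖ = 1`. -/
structure RISpace where
  /-- the underlying vector space of classes of measurable functions -/
  carrier : Submodule ℝ UnitFun
  /-- the norm -/
  norm : carrier → ℝ
  norm_nonneg : ∀ f, 0 ≤ norm f
  eq_zero_of_norm : ∀ f, norm f = 0 → f = 0
  norm_smul : ∀ (c : ℝ) (f : carrier), norm (c • f) = |c| * norm f
  norm_add_le : ∀ f g : carrier, norm (f + g) ≤ norm f + norm g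
  complete : ∀ u : ℕ → carrier,
    (∀ ε : ℝ, 0 < ε → ∃ N : ℕ, ∀ i j : ℕ, N ≤ i → N ≤ j → norm (u i - u j) < ε) →
    ∃ f : carrier, Filter.Tendsto (fun i => norm (u i - f)) Filter.atTop (nhds 0)
  rearr : ∀ (f : UnitFun) (g : carrier),
    (∀ t ∈ Set.Ioo (0 : ℝ) 1, decRearr f t ≤ decRearr g.1 t) →
    ∃ hf : f ∈ carrier, norm ⟨f, hf⟩ ≤ norm g
  one_mem : (1 : UnitFun) ∈ carrier
  norm_one : norm ⟨1, one_mem⟩ = 1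

/-- Bounded functions belong to every r.i. space. -/
theorem RISpace.mem_of_bound (E : RISpace) (f : UnitFun) (c : ℝ)
    (h : ∀ᵐ t ∂unitMeasure, |f t| ≤ c) : f ∈ E.carrier := by
  have hg : (|c|) • (1 : UnitFun) ∈ E.carrier := E.carrier.smul_mem _ E.one_mem
  have hc : ∀ᵐ t ∂unitMeasure, (((|c|) • (1 : UnitFun) : UnitFun) t) = |c| := by
    filter_upwards [AEEqFun.coeFn_smul (|c|) (1 : UnitFun),
      AEEqFun.coeFn_one (μ := unitMeasure) (β := ℝ) (α := ℝ)] with t h1 h2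
    rw [h1, Pi.smul_apply, h2]
    simp
  refine (E.rearr f ⟨_, hg⟩ ?_).1
  intro t _
  unfold decRearr
  refine csInf_le_csInf ⟨0, fun s hs => hs.1⟩ ⟨|c|, abs_nonneg c, ?_⟩ ?_
  · have : unitMeasure {u : ℝ | |c| < |((|c|) • (1 : UnitFun) : UnitFun) u|} = 0 := by
      refine measure_mono_null ?_ (ae_iff.1 hc)
      intro u hu hu'
      have hu1 : |c| < |((|c|) • (1 : UnitFun) : UnitFun) u| := hu
      rw [hu', abs_abs] at hu1
      exact lt_irrefl _ hu1
    rw [this]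
    exact bot_le
  · intro s hs
    refine ⟨hs.1, le_trans (measure_mono_ae ?_) hs.2⟩
    filter_upwards [h, hc] with u hu1 hu2 hu3
    have hu4 : s < |f u| := hu3
    change s < |((|c|) • (1 : UnitFun) : UnitFun) u|
    rw [hu2, abs_abs]
    exact hu4.trans_le (hu1.trans (le_abs_self c))

/-- A finite linear combination of indicators of measurable subsets of `ℝ`, with its
measurability and boundedness. -/
theorem measurable_step {ι : Type} (s : Finset ι) (a : ι → ℝ) (A : ι → Set ℝ)
    (hA : ∀ i, MeasurableSet (A i)) :
    Measurable (fun t : ℝ => ∑ i ∈ s, (A i).indicator (fun _ => a i) t) :=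
  Finset.measurable_sum _ fun i _ => measurable_const.indicator (hA i)

theorem step_bound {ι : Type} (s : Finset ι) (a : ι → ℝ) (A : ι → Set ℝ) (t : ℝ) :
    |∑ i ∈ s, (A i).indicator (fun _ => a i) t| ≤ ∑ i ∈ s, |a i| := by
  classical
  refine (Finset.abs_sum_le_sum_abs _ _).trans (Finset.sum_le_sum fun i _ => ?_)
  by_cases h : t ∈ A i
  · simp [h]
  · simp [h]

/-- `xStar x k` is `x_k^*`, the `k`-th term (`1 ≤ k ≤ n ^ 2`) of the rearrangement of the
family `|x i j|` in decreasing order. -/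
def xStar {n : ℕ} (x : Matrix (Fin n) (Fin n) ℝ) (k : ℕ) : ℝ :=
  (((Finset.univ : Finset (Fin n × Fin n)).val.map fun p => |x p.1 p.2|).sort
    (· ≥ ·)).getD (k - 1) 0

/-- `T_q x` as a function: for a numbering `ℓ` of the permutations by `0, …, n! - 1`, it equals
`(∑ i, |x i (π i)| ^ q) ^ (1 / q)` on `[ℓ π / n!, (ℓ π + 1) / n!)`. -/
def TqFun {n : ℕ} (ℓ : Equiv.Perm (Fin n) ≃ Fin n.factorial) (q : ℝ)
    (x : Matrix (Fin n) (Fin n) ℝ) (t : ℝ) : ℝ :=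
  ∑ π : Equiv.Perm (Fin n),
    (Set.Ico (((ℓ π : ℕ) : ℝ) / (n.factorial : ℝ))
      ((((ℓ π : ℕ) : ℝ) + 1) / (n.factorial : ℝ))).indicator
      (fun _ => (∑ i : Fin n, |x i (π i)| ^ q) ^ (1 / q)) t

/-- `U x` as a function: it equals `x_k^*` on `((k - 1) / n, k / n)` for `1 ≤ k ≤ n`. -/
def UFun {n : ℕ} (x : Matrix (Fin n) (Fin n) ℝ) (t : ℝ) : ℝ :=
  ∑ k ∈ Finset.Icc 1 n,
    (Set.Ioo (((k : ℝ) - 1) / (n : ℝ)) ((k : ℝ) / (n : ℝ))).indicator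
      (fun _ => xStar x k) t

theorem measurable_TqFun {n : ℕ} (ℓ : Equiv.Perm (Fin n) ≃ Fin n.factorial) (q : ℝ)
    (x : Matrix (Fin n) (Fin n) ℝ) : Measurable (TqFun ℓ q x) :=
  measurable_step _ _ _ fun _ => measurableSet_Ico

theorem measurable_UFun {n : ℕ} (x : Matrix (Fin n) (Fin n) ℝ) : Measurable (UFun x) :=
  measurable_step _ _ _ fun _ => measurableSet_Ioo

/-- `T_q x` as an element of the r.i. space `E`. -/
def Tq (E : RISpace) {n : ℕ} (ℓ : Equiv.Perm (Fin n) ≃ Fin n.factorial) (q : ℝ)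
    (x : Matrix (Fin n) (Fin n) ℝ) : E.carrier :=
  ⟨AEEqFun.mk (TqFun ℓ q x) (measurable_TqFun ℓ q x).aestronglyMeasurable,
    E.mem_of_bound _ _ (by
      filter_upwards [AEEqFun.coeFn_mk (TqFun ℓ q x)
        (measurable_TqFun ℓ q x).aestronglyMeasurable] with t ht
      rw [ht]
      exact step_bound _ _ _ t)⟩

/-- `U x` as an element of the r.i. space `E`. -/
def UOp (E : RISpace) {n : ℕ} (x : Matrix (Fin n) (Fin n) ℝ) : E.carrier :=
  ⟨AEEqFun.mk (UFun x) (measurable_UFun x).aestronglyMeasurable,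
    E.mem_of_bound _ _ (by
      filter_upwards [AEEqFun.coeFn_mk (UFun x)
        (measurable_UFun x).aestronglyMeasurable] with t ht
      rw [ht]
      exact step_bound _ _ _ t)⟩

end

/-! Write x = y + z, where y keeps the n positions carrying the n largest |x_ij| and z keeps the
rest; by Minkowski, T_q x is pointwise at most T_q y + T_q z. Everything else compares distribution
functions on the n! permutations: in an r.i. space, a distribution function at most three times
another costs at most a factor 3 in norm (`RISpace.norm_step_le_three_mul`).

For y: the random set of the n positions met by π is dominated, up to the factor 3, by the fixed
point set of π (`card_hitFinset_mem_le`), because m! ≤ 3 D_m for the derangement numbers with m ≠ 1.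
So y may be replaced by a diagonal matrix with the same entries, and the hypothesis gives ‖T_q y‖ ≤
3C‖Ux‖.

For z: put M = x_n^*, let A be the tail term of the conclusion, and w = (|z|/(M + A))^q. Then the
largest entry of w plus its average row sum is at most 1. Markov's inequality for elementary
symmetric polynomials and Maclaurin's inequality bound the tails of ∑ w_{i,π(i)} by three times
those of the number of fixed points (`card_le_sum_perm_le_fixed`), which is (T_q 1)^q. Hence ‖T_q z‖
≤ (M + A)(1 + 3C) ≤ 4C(‖Ux‖ + A), and 3C + 4C = 7C. -/

/-! ### Step functions and comparison of norms in an r.i. space. -/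

/-- The step function on `[0,1)` with value `f i` on `[i / N, (i + 1) / N)`. -/
noncomputable def stepFun {N : ℕ} (f : Fin N → ℝ) (t : ℝ) : ℝ :=
  ∑ i : Fin N, (Set.Ico (((i : ℕ) : ℝ) / (N : ℝ)) ((((i : ℕ) : ℝ) + 1) / (N : ℝ))).indicator
    (fun _ => f i) t

theorem measurable_stepFun {N : ℕ} (f : Fin N → ℝ) : Measurable (stepFun f) :=
  measurable_step _ _ _ fun _ => measurableSet_Ico

theorem abs_stepFun_le {N : ℕ} (f : Fin N → ℝ) (t : ℝ) : |stepFun f t| ≤ ∑ i, |f i| :=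
  step_bound _ _ _ t

/-- A bounded measurable function as an element of a rearrangement invariant space. -/
noncomputable def RISpace.ofBounded (E : RISpace) (f : ℝ → ℝ) (hf : Measurable f)
    (hb : ∃ c, ∀ t, |f t| ≤ c) : E.carrier :=
  ⟨AEEqFun.mk f hf.aestronglyMeasurable, by
    obtain ⟨c, hc⟩ := hb
    refine E.mem_of_bound _ c ?_
    filter_upwards [AEEqFun.coeFn_mk f hf.aestronglyMeasurable] with t ht
    rw [ht]
    exact hc t⟩

/-- Every level admissible in the infimum for g^* is admissible for f^*. Boundedness of g keeps the
former set nonempty, so that `sInf` is monotone there. -/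
theorem RISpace.norm_le_of_measure_le (E : RISpace) {f g : ℝ → ℝ} (hf : Measurable f)
    (hg : Measurable g) (hfb : ∃ c, ∀ t, |f t| ≤ c) (hgb : ∃ c, ∀ t, |g t| ≤ c)
    (h : ∀ s : ℝ, 0 ≤ s → unitMeasure {u | s < |f u|} ≤ unitMeasure {u | s < |g u|}) :
    E.norm (E.ofBounded f hf hfb) ≤ E.norm (E.ofBounded g hg hgb) := by
  have key : ∀ (k : ℝ → ℝ) (hk : Measurable k) (s : ℝ),
      unitMeasure {u | s < |(AEEqFun.mk k hk.aestronglyMeasurable : UnitFun) u|}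
        = unitMeasure {u | s < |k u|} := by
    intro k hk s
    refine measure_congr ?_
    filter_upwards [AEEqFun.coeFn_mk (μ := unitMeasure) k hk.aestronglyMeasurable] with u hu
    change (s < |(AEEqFun.mk k hk.aestronglyMeasurable : UnitFun) u|) = (s < |k u|)
    rw [hu]
  obtain ⟨_, h2⟩ := E.rearr (E.ofBounded f hf hfb).1 (E.ofBounded g hg hgb) (by
    intro t ht
    obtain ⟨c, hc⟩ := hgb
    unfold decRearr RISpace.ofBounded
    refine csInf_le_csInf ⟨0, fun s hs => hs.1⟩ ⟨|c|, abs_nonneg c, ?_⟩ ?_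
    · rw [key g hg]
      have : {u | |c| < |g u|} = ∅ := by
        ext u
        simpa using (hc u).trans (le_abs_self c)
      rw [this]
      simp
    · rintro s ⟨hs, hs'⟩
      rw [key g hg] at hs'
      refine ⟨hs, ?_⟩
      rw [key f hf]
      exact (h s hs).trans hs')
  exact h2

theorem RISpace.norm_le_of_abs_le (E : RISpace) {f g : ℝ → ℝ} (hf : Measurable f)
    (hg : Measurable g) (hfb : ∃ c, ∀ t, |f t| ≤ c) (hgb : ∃ c, ∀ t, |g t| ≤ c)
    (h : ∀ᵐ t ∂unitMeasure, |f t| ≤ |g t|) :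
    E.norm (E.ofBounded f hf hfb) ≤ E.norm (E.ofBounded g hg hgb) := by
  refine E.norm_le_of_measure_le hf hg hfb hgb fun s _ => measure_mono_ae ?_
  filter_upwards [h] with u hu hs
  exact lt_of_lt_of_le hs hu

/-- The step function with values `f i`, as an element of a rearrangement invariant space. -/
noncomputable def RISpace.step (E : RISpace) {N : ℕ} (f : Fin N → ℝ) : E.carrier :=
  E.ofBounded (stepFun f) (measurable_stepFun f) ⟨_, abs_stepFun_le f⟩

theorem stepFun_add {N : ℕ} (f g : Fin N → ℝ) : stepFun (f + g) = stepFun f + stepFun g := by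
  funext t
  simp only [stepFun, Pi.add_apply, ← Finset.sum_add_distrib]
  refine Finset.sum_congr rfl fun i _ => ?_
  simp only [Set.indicator_apply]
  split_ifs <;> simp

theorem stepFun_smul {N : ℕ} (c : ℝ) (f : Fin N → ℝ) : stepFun (c • f) = c • stepFun f := by
  funext t
  simp only [stepFun, Pi.smul_apply, smul_eq_mul, Finset.mul_sum]
  refine Finset.sum_congr rfl fun i _ => ?_
  simp only [Set.indicator_apply]
  split_ifs <;> simp

theorem RISpace.step_add (E : RISpace) {N : ℕ} (f g : Fin N → ℝ) :
    E.step (f + g) = E.step f + E.step g := by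
  apply Subtype.ext
  simp only [RISpace.step, RISpace.ofBounded, stepFun_add, Submodule.coe_add]
  rfl

theorem RISpace.step_smul (E : RISpace) {N : ℕ} (c : ℝ) (f : Fin N → ℝ) :
    E.step (c • f) = c • E.step f := by
  apply Subtype.ext
  simp only [RISpace.step, RISpace.ofBounded, stepFun_smul, Submodule.coe_smul]
  rfl

theorem mem_Ico_div_iff_floor {N : ℕ} (hN : 0 < N) (i : ℕ) (t : ℝ) (ht : 0 ≤ t) :
    t ∈ Set.Ico ((i : ℝ) / (N : ℝ)) (((i : ℝ) + 1) / (N : ℝ)) ↔ ⌊t * N⌋₊ = i := by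
  have hN' : (0 : ℝ) < N := by exact_mod_cast hN
  rw [Set.mem_Ico, div_le_iff₀ hN', lt_div_iff₀ hN', Nat.floor_eq_iff (by positivity)]

theorem stepFun_eq_of_mem {N : ℕ} (f : Fin N → ℝ) (i : Fin N) {t : ℝ}
    (ht : t ∈ Set.Ico (((i : ℕ) : ℝ) / (N : ℝ)) ((((i : ℕ) : ℝ) + 1) / (N : ℝ))) :
    stepFun f t = f i := by
  have hN : 0 < N := i.pos
  have h0 : 0 ≤ t := le_trans (by positivity) ht.1
  rw [stepFun, Finset.sum_eq_single i]
  · simp [ht]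
  · intro j _ hj
    refine Set.indicator_of_notMem (fun hj' => hj ?_) _
    rw [mem_Ico_div_iff_floor hN _ _ h0] at ht hj'
    exact Fin.ext (hj'.symm.trans ht)
  · simp

theorem setOf_lt_abs_stepFun {N : ℕ} (f : Fin N → ℝ) {s : ℝ} (hs : 0 ≤ s) :
    {u | s < |stepFun f u|} = ⋃ i ∈ Finset.univ.filter (fun i => s < |f i|),
      Set.Ico (((i : ℕ) : ℝ) / (N : ℝ)) ((((i : ℕ) : ℝ) + 1) / (N : ℝ)) := by
  ext u
  simp only [Set.mem_ofPred_eq, Finset.mem_filter, Finset.mem_univ, true_and, Set.mem_iUnion,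
    exists_prop]
  constructor
  · intro hu
    by_contra! hc
    have h0 : stepFun f u ≠ 0 := by
      intro h0
      rw [h0, abs_zero] at hu
      exact absurd hu (not_lt.2 hs)
    obtain ⟨i, -, hi⟩ := Finset.exists_ne_zero_of_sum_ne_zero h0
    have hm := Set.mem_of_indicator_ne_zero hi
    rw [stepFun_eq_of_mem f i hm] at hu
    exact hc i hu hm
  · rintro ⟨i, hi, hu⟩
    rwa [stepFun_eq_of_mem f i hu]

theorem measure_lt_abs_stepFun {N : ℕ} (f : Fin N → ℝ) {s : ℝ} (hs : 0 ≤ s) :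
    unitMeasure {u | s < |stepFun f u|}
      = (Finset.univ.filter (fun i => s < |f i|)).card * ENNReal.ofReal (1 / N) := by
  rw [setOf_lt_abs_stepFun f hs, measure_biUnion_finset]
  · rw [Finset.sum_congr rfl (g := fun _ => ENNReal.ofReal (1 / N)), Finset.sum_const,
      nsmul_eq_mul]
    intro i _
    have hN : (0 : ℝ) < N := by exact_mod_cast i.pos
    have hi : ((i : ℕ) : ℝ) + 1 ≤ N := by exact_mod_cast i.2
    rw [Measure.restrict_apply measurableSet_Ico, Set.inter_eq_left.2, Real.volume_Ico]
    · congr 1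
      ring
    · intro t ht
      refine ⟨le_trans (by positivity) ht.1, ht.2.le.trans ?_⟩
      rwa [div_le_one hN]
  · intro i _ j _ hij
    refine Set.disjoint_left.2 fun t hi hj => hij ?_
    have h0 : 0 ≤ t := le_trans (by positivity) hi.1
    rw [mem_Ico_div_iff_floor i.pos _ _ h0] at hi hj
    exact Fin.ext (hi.symm.trans hj)
  · exact fun _ _ => measurableSet_Ico

theorem RISpace.norm_step_le_of_card_le (E : RISpace) {N : ℕ} {f g : Fin N → ℝ}
    (h : ∀ s : ℝ, 0 ≤ s → (Finset.univ.filter (fun i => s < |f i|)).card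
      ≤ (Finset.univ.filter (fun i => s < |g i|)).card) :
    E.norm (E.step f) ≤ E.norm (E.step g) := by
  refine E.norm_le_of_measure_le _ _ _ _ fun s hs => ?_
  rw [measure_lt_abs_stepFun f hs, measure_lt_abs_stepFun g hs]
  exact mul_le_mul_left (Nat.cast_le.2 (h s hs)) _

theorem RISpace.norm_step_mono (E : RISpace) {N : ℕ} {f g : Fin N → ℝ}
    (h : ∀ i, |f i| ≤ |g i|) : E.norm (E.step f) ≤ E.norm (E.step g) := by
  refine E.norm_step_le_of_card_le fun s _ => Finset.card_le_card fun i => ?_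
  simp only [Finset.mem_filter, Finset.mem_univ, true_and]
  exact fun hs => hs.trans_le (h i)

theorem RISpace.norm_step_comp_perm (E : RISpace) {N : ℕ} (f : Fin N → ℝ)
    (σ : Equiv.Perm (Fin N)) : E.norm (E.step (f ∘ σ)) = E.norm (E.step f) := by
  have h : ∀ s : ℝ, (Finset.univ.filter (fun i => s < |(f ∘ σ) i|)).card
      = (Finset.univ.filter (fun i => s < |f i|)).card := fun s =>
    Finset.card_equiv σ (by simp)
  exact le_antisymm (E.norm_step_le_of_card_le fun s _ => (h s).le)
    (E.norm_step_le_of_card_le fun s _ => (h s).ge)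

theorem RISpace.ofBounded_one (E : RISpace) :
    E.ofBounded (fun _ => 1) measurable_const ⟨1, by simp⟩ = ⟨1, E.one_mem⟩ := by
  apply Subtype.ext
  rfl

theorem RISpace.norm_ofBounded_const (E : RISpace) {c : ℝ} (hc : 0 ≤ c) :
    E.norm (E.ofBounded (fun _ => c) measurable_const ⟨|c|, fun _ => le_rfl⟩) = c := by
  have : E.ofBounded (fun _ => c) measurable_const ⟨|c|, fun _ => le_rfl⟩
      = c • E.ofBounded (fun _ => 1) measurable_const ⟨1, by simp⟩ := by
    apply Subtype.ext
    simp only [RISpace.ofBounded, Submodule.coe_smul]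
    congr 1
    funext t
    simp
  rw [this, E.norm_smul, E.ofBounded_one, E.norm_one, abs_of_nonneg hc, mul_one]

/-- Only an inequality, since for N = 0 the step function vanishes. -/
theorem RISpace.norm_step_one_le (E : RISpace) {N : ℕ} :
    E.norm (E.step (fun _ : Fin N => 1)) ≤ 1 := by
  refine le_of_le_of_eq ?_ (E.norm_ofBounded_const zero_le_one)
  refine E.norm_le_of_abs_le _ _ _ _ (Filter.Eventually.of_forall fun t => ?_)
  by_cases h : stepFun (fun _ : Fin N => (1 : ℝ)) t = 0
  · simp [h]
  · obtain ⟨i, -, hi⟩ := Finset.exists_ne_zero_of_sum_ne_zero h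
    rw [stepFun_eq_of_mem _ i (Set.mem_of_indicator_ne_zero hi)]

/-- If the distribution function of `f` is at most three times that of `g`, then the norm of `f`
is at most three times that of `g`. -/
theorem RISpace.norm_step_le_three_mul (E : RISpace) {N : ℕ} {f g : Fin N → ℝ}
    (h : ∀ s : ℝ, 0 ≤ s → (Finset.univ.filter (fun i => s < |f i|)).card
      ≤ 3 * (Finset.univ.filter (fun i => s < |g i|)).card) :
    E.norm (E.step f) ≤ 3 * E.norm (E.step g) := by
  set σ := Tuple.sort (fun i => -|f i|) with hσ
  set τ := Tuple.sort (fun i => -|g i|) with hτ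
  have hf : ∀ i j, i ≤ j → |f (σ j)| ≤ |f (σ i)| := fun i j hij => by
    simpa using Tuple.monotone_sort (fun i => -|f i|) hij
  have hg : ∀ i j, i ≤ j → |g (τ j)| ≤ |g (τ i)| := fun i j hij => by
    simpa using Tuple.monotone_sort (fun i => -|g i|) hij
  -- With both families sorted decreasingly, the i-th value of |f| will lie below the (i/3)-th value
  -- of |g|.
  let k : Fin N → Fin N := fun i => ⟨(i : ℕ) / 3, lt_of_le_of_lt (Nat.div_le_self _ _) i.2⟩
  have hle : ∀ i, |f (σ i)| ≤ |g (τ (k i))| := by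
    intro i
    by_contra! hc
    have h1 : (i : ℕ) + 1 ≤
        (Finset.univ.filter (fun j => |g (τ (k i))| < |f j|)).card := by
      rw [← Fin.card_Iic]
      refine Finset.card_le_card_of_injOn σ (fun j hj => ?_) σ.injective.injOn
      simp only [Finset.coe_Iic, Set.mem_Iic] at hj
      simpa using hc.trans_le (hf j i hj)
    have h2 : (Finset.univ.filter (fun j => |g (τ (k i))| < |g j|)).card ≤ (i : ℕ) / 3 := by
      have : (Finset.Iio (k i)).card = (i : ℕ) / 3 := by rw [Fin.card_Iio]
      rw [← this]
      refine Finset.card_le_card_of_injOn τ.symm (fun j hj => ?_) τ.symm.injective.injOn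
      simp only [Finset.coe_filter, Finset.mem_univ, true_and, Set.mem_ofPred_eq] at hj
      simp only [Finset.coe_Iio, Set.mem_Iio]
      by_contra! hc'
      have := hg _ _ hc'
      rw [Equiv.apply_symm_apply] at this
      exact absurd hj (not_lt.2 this)
    have h3 := h _ (abs_nonneg (g (τ (k i))))
    omega
  -- On each residue class mod 3 the map i ↦ i/3 is injective, so each `p r` takes every value of
  -- |g| at most as often as g does.
  let p : ℕ → Fin N → ℝ := fun r i => if (i : ℕ) % 3 = r then |g (τ (k i))| else 0
  have hp : ∀ r, E.norm (E.step (p r)) ≤ E.norm (E.step g) := by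
    intro r
    refine E.norm_step_le_of_card_le fun s hs => ?_
    refine Finset.card_le_card_of_injOn (fun i => τ (k i)) (fun i hi => ?_) ?_
    · simp only [Finset.coe_filter, Finset.mem_univ, true_and, Set.mem_ofPred_eq, p] at hi ⊢
      split_ifs at hi
      · simpa using hi
      · rw [abs_zero] at hi
        exact absurd hi (not_lt.2 hs)
    · intro i hi j hj hij
      have hmod : ∀ i, s < |p r i| → (i : ℕ) % 3 = r := by
        intro i hi
        by_contra hc
        simp only [p, if_neg hc, abs_zero] at hi
        exact absurd hi (not_lt.2 hs)
      simp only [Finset.coe_filter, Finset.mem_univ, true_and, Set.mem_ofPred_eq] at hi hj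
      have h1 := hmod i hi
      have h2 := hmod j hj
      have h3 : (i : ℕ) / 3 = (j : ℕ) / 3 := by
        simpa [k] using hij
      exact Fin.ext (by omega)
  have hsum : E.norm (E.step (f ∘ σ)) ≤ E.norm (E.step (p 0 + p 1 + p 2)) := by
    refine E.norm_step_mono fun i => ?_
    have : (p 0 + p 1 + p 2) i = |g (τ (k i))| := by
      have : (i : ℕ) % 3 = 0 ∨ (i : ℕ) % 3 = 1 ∨ (i : ℕ) % 3 = 2 := by omega
      rcases this with h | h | h <;> simp [p, h]
    rw [this, abs_abs]
    exact hle i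
  rw [E.norm_step_comp_perm, E.step_add, E.step_add] at hsum
  have h1 := E.norm_add_le (E.step (p 0) + E.step (p 1)) (E.step (p 2))
  have h2 := E.norm_add_le (E.step (p 0)) (E.step (p 1))
  have := hp 0
  have := hp 1
  have := hp 2
  linarith

theorem Tq_eq_step (E : RISpace) {n : ℕ} (ℓ : Equiv.Perm (Fin n) ≃ Fin n.factorial) (q : ℝ)
    (x : Matrix (Fin n) (Fin n) ℝ) :
    Tq E ℓ q x
      = E.step (fun i => (∑ j : Fin n, |x j (ℓ.symm i j)| ^ q) ^ (1 / q)) := by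
  have h : TqFun ℓ q x = stepFun (fun i => (∑ j : Fin n, |x j (ℓ.symm i j)| ^ q) ^ (1 / q)) := by
    funext t
    unfold TqFun stepFun
    refine Fintype.sum_equiv ℓ _ _ fun π => ?_
    simp only [Equiv.symm_apply_apply]
  apply Subtype.ext
  simp only [Tq, RISpace.step, RISpace.ofBounded, h]

theorem UOp_eq_ofBounded (E : RISpace) {n : ℕ} (x : Matrix (Fin n) (Fin n) ℝ) :
    UOp E x = E.ofBounded (UFun x) (measurable_UFun x) ⟨_, step_bound _ _ _⟩ := rfl

/-! ### Derangement numbers and permutations through prescribed positions. -/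

/-- Factorials and derangement numbers satisfy the same recursion u (m+2) = (m+1)(u m + u (m+1)), so
two consecutive cases propagate. Equality holds at m = 3, and D_1 = 0 forces the exception. -/
theorem factorial_le_three_mul_numDerangements {m : ℕ} (hm : m ≠ 1) :
    m.factorial ≤ 3 * numDerangements m := by
  rcases m with _ | _ | m
  · simp
  · exact absurd rfl hm
  have h : ∀ m : ℕ, (m + 2).factorial ≤ 3 * numDerangements (m + 2) ∧
      (m + 3).factorial ≤ 3 * numDerangements (m + 3) := by
    intro m
    induction m with
    | zero => decide
    | succ m ih =>
      refine ⟨ih.2, ?_⟩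
      obtain ⟨h1, h2⟩ := ih
      have e : (m + 1 + 3).factorial = (m + 3) * ((m + 2).factorial + (m + 3).factorial) := by
        simp only [Nat.factorial_succ]
        ring
      rw [e, show m + 1 + 3 = (m + 2) + 2 by ring, numDerangements_add_two]
      calc (m + 3) * ((m + 2).factorial + (m + 3).factorial)
          ≤ (m + 3) * (3 * numDerangements (m + 2) + 3 * numDerangements (m + 3)) := by gcongr
        _ = _ := by ring
  exact (h m).1

section Counting

variable {n : ℕ}

theorem card_perm_fixing (R : Finset (Fin n)) :
    (Finset.univ.filter (fun π : Equiv.Perm (Fin n) => ∀ i ∈ R, π i = i)).card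
      = (n - R.card).factorial := by
  have e := Fintype.card_congr (Equiv.Perm.subtypeEquivSubtypePerm (fun i : Fin n => i ∉ R))
  rw [Fintype.card_perm, Fintype.card_subtype_compl, Fintype.card_fin, Fintype.card_coe,
    Fintype.card_subtype] at e
  rw [e]
  congr 1
  ext π
  simp

/-- At most `(n - |B|)!` permutations satisfy `|B|` distinct requirements `π (ρ i) = κ i`. -/
theorem card_perm_constraints_le {ρ κ : Fin n → Fin n}
    (hp : Function.Injective fun i => (ρ i, κ i)) (B : Finset (Fin n)) :
    (Finset.univ.filter (fun π : Equiv.Perm (Fin n) => ∀ i ∈ B, π (ρ i) = κ i)).card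
      ≤ (n - B.card).factorial := by
  rcases Finset.eq_empty_or_nonempty
    (Finset.univ.filter (fun π : Equiv.Perm (Fin n) => ∀ i ∈ B, π (ρ i) = κ i)) with h | ⟨π₀, h⟩
  · rw [h]
    simp
  · simp only [Finset.mem_filter, Finset.mem_univ, true_and] at h
    have hinj : Set.InjOn ρ B := by
      intro i hi j hj hij
      refine hp (Prod.ext hij ?_)
      simp only
      rw [← h i hi, ← h j hj, hij]
    rw [← Finset.card_image_of_injOn hinj, ← card_perm_fixing]
    refine Finset.card_le_card_of_injOn (fun π => π₀⁻¹ * π) (fun π hπ => ?_)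
      (mul_right_injective _).injOn
    simp only [Finset.coe_filter, Finset.mem_univ, true_and, Set.mem_ofPred_eq,
      Finset.mem_image, forall_exists_index, and_imp, forall_apply_eq_imp_iff₂] at hπ ⊢
    intro i hi
    rw [Equiv.Perm.mul_apply, hπ i hi, Equiv.Perm.inv_eq_iff_eq, h i hi]

/-- The set of fixed points of a permutation. -/
def fixedFinset (π : Equiv.Perm (Fin n)) : Finset (Fin n) :=
  Finset.univ.filter fun i => π i = i

theorem card_fixedFinset_eq (B : Finset (Fin n)) :
    (Finset.univ.filter (fun π : Equiv.Perm (Fin n) => fixedFinset π = B)).card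
      = numDerangements (n - B.card) := by
  have e := Fintype.card_congr (derangements.subtypeEquiv (fun i : Fin n => i ∉ B))
  rw [card_derangements_eq_numDerangements, Fintype.card_subtype_compl, Fintype.card_fin,
    Fintype.card_coe, Fintype.card_subtype] at e
  rw [e]
  congr 1
  ext π
  simp only [Finset.mem_filter, Finset.mem_univ, true_and, fixedFinset, Finset.ext_iff,
    Function.mem_fixedPoints, Function.IsFixedPt, not_not]
  exact forall_congr' fun _ => iff_comm

/-- The indices `i` for which `π` passes through the position `(ρ i, κ i)`. -/
def hitFinset (ρ κ : Fin n → Fin n) (π : Equiv.Perm (Fin n)) : Finset (Fin n) :=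
  Finset.univ.filter fun i => π (ρ i) = κ i

/-- The graph of a permutation meets each row and each column only once. -/
theorem notMem_hitFinset_of_conflict {ρ κ : Fin n → Fin n}
    (hp : Function.Injective fun i => (ρ i, κ i)) {a b : Fin n} (hne : a ≠ b)
    (hc : ρ a = ρ b ∨ κ a = κ b) (π : Equiv.Perm (Fin n)) :
    a ∉ hitFinset ρ κ π ∨ b ∉ hitFinset ρ κ π := by
  by_contra! h
  simp only [hitFinset, Finset.mem_filter, Finset.mem_univ, true_and] at h
  apply hne
  apply hp
  rcases hc with hc | hc
  · refine Prod.ext hc ?_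
    simp only
    rw [← h.1, ← h.2, hc]
  · refine Prod.ext (π.injective ?_) hc
    simp only
    rw [h.1, h.2, hc]

theorem card_hitFinset_eq_le {ρ κ : Fin n → Fin n} (hp : Function.Injective fun i => (ρ i, κ i))
    (B : Finset (Fin n)) :
    (Finset.univ.filter (fun π : Equiv.Perm (Fin n) => hitFinset ρ κ π = B)).card
      ≤ (n - B.card).factorial := by
  refine le_trans (Finset.card_le_card fun π => ?_) (card_perm_constraints_le hp B)
  simp only [Finset.mem_filter, Finset.mem_univ, true_and]
  rintro rfl i hi
  simpa [hitFinset] using hi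

/-- The bijection π ↦ κ⁻¹πρ of the symmetric group turns hits into fixed points. -/
theorem card_hitFinset_mem_of_bijective {ρ κ : Fin n → Fin n} (hρ : Function.Bijective ρ)
    (hκ : Function.Bijective κ) (S : Finset (Finset (Fin n))) :
    (Finset.univ.filter (fun π : Equiv.Perm (Fin n) => hitFinset ρ κ π ∈ S)).card
      = (Finset.univ.filter (fun π : Equiv.Perm (Fin n) => fixedFinset π ∈ S)).card := by
  let r := Equiv.ofBijective ρ hρ
  let k := Equiv.ofBijective κ hκ
  refine Finset.card_equiv ((Equiv.mulLeft k⁻¹).trans (Equiv.mulRight r)) fun π => ?_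
  have : hitFinset ρ κ π = fixedFinset (k⁻¹ * π * r) := by
    ext i
    simp only [hitFinset, fixedFinset, Finset.mem_filter, Finset.mem_univ, true_and,
      Equiv.Perm.mul_apply, Equiv.Perm.inv_eq_iff_eq]
    exact Iff.rfl
  simp [this]

/-- For `n` distinct positions, the set of positions met by a random permutation is, up to a
factor three, dominated by the set of fixed points of a random permutation. -/
theorem card_hitFinset_mem_le {ρ κ : Fin n → Fin n}
    (hp : Function.Injective fun i => (ρ i, κ i)) (S : Finset (Finset (Fin n)))
    (hS : ∀ A ∈ S, ∀ B, A ⊆ B → B ∈ S) :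
    (Finset.univ.filter (fun π : Equiv.Perm (Fin n) => hitFinset ρ κ π ∈ S)).card
      ≤ 3 * (Finset.univ.filter (fun π : Equiv.Perm (Fin n) => fixedFinset π ∈ S)).card := by
  by_cases hc : ∃ i j, i ≠ j ∧ (ρ i = ρ j ∨ κ i = κ j)
  swap
  · push Not at hc
    have hρ : Function.Injective ρ := fun i j hij => by
      by_contra h
      exact (hc i j h).1 hij
    have hκ : Function.Injective κ := fun i j hij => by
      by_contra h
      exact (hc i j h).2 hij
    rw [card_hitFinset_mem_of_bijective (Finite.injective_iff_bijective.1 hρ)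
      (Finite.injective_iff_bijective.1 hκ)]
    omega
  obtain ⟨a, b, hne, hab⟩ := hc
  have hmiss : ∀ (π : Equiv.Perm (Fin n)) (B : Finset (Fin n)), hitFinset ρ κ π = B →
      a ∉ B ∨ b ∉ B := by
    rintro π _ rfl
    exact notMem_hitFinset_of_conflict hp hne hab π
  have hfib : ∀ (f : Equiv.Perm (Fin n) → Finset (Fin n)),
      (Finset.univ.filter (fun π => f π ∈ S)).card
        = ∑ B ∈ S, (Finset.univ.filter (fun π => f π = B)).card := by
    intro f
    rw [Finset.card_eq_sum_card_fiberwise (f := f) (t := S) (fun π hπ => by simpa using hπ)]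
    refine Finset.sum_congr rfl fun B hB => ?_
    congr 1
    ext π
    simp only [Finset.mem_filter, Finset.mem_univ, true_and, and_iff_right_iff_imp]
    rintro rfl
    exact hB
  rw [hfib, hfib]
  -- As S is closed under supersets, it is empty unless it contains the full set.
  by_cases huniv : Finset.univ ∈ S
  swap
  · have : S = ∅ := Finset.eq_empty_of_forall_notMem fun A hA =>
      huniv (hS A hA _ (Finset.subset_univ _))
    simp [this]
  -- The estimate (n - |B|)! ≤ 3 D_{n-|B|} fails only for |B| = n - 1. A hit set omits a or b, so
  -- only these two sets are exceptional, each hit by at most one permutation.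
  set T : Finset (Finset (Fin n)) := {Finset.univ.erase a, Finset.univ.erase b} with hT
  have hfix : (Finset.univ.filter
      (fun π : Equiv.Perm (Fin n) => fixedFinset π = Finset.univ)).card = 1 := by
    rw [card_fixedFinset_eq]
    simp
  have hcase : ∀ B ∈ S.erase Finset.univ, B ∉ T →
      (Finset.univ.filter (fun π : Equiv.Perm (Fin n) => hitFinset ρ κ π = B)).card
        ≤ 3 * (Finset.univ.filter (fun π : Equiv.Perm (Fin n) => fixedFinset π = B)).card := by
    intro B hB hBT
    by_cases hcard : n - B.card = 1
    · have h1 : Bᶜ.card = 1 := by rw [Finset.card_compl, Fintype.card_fin, hcard]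
      obtain ⟨c, hc'⟩ := Finset.card_eq_one.1 h1
      have hBc : B = Finset.univ.erase c := by
        rw [← compl_compl B, hc']
        ext
        simp
      rw [Finset.filter_eq_empty_iff.2]
      · simp
      · intro π _ hπ
        apply hBT
        rw [hT, Finset.mem_insert, Finset.mem_singleton]
        rcases hmiss π B hπ with h | h
        · left
          have : a = c := by simpa [hBc] using h
          rw [this, hBc]
        · right
          have : b = c := by simpa [hBc] using h
          rw [this, hBc]
    · rw [card_fixedFinset_eq]
      exact (card_hitFinset_eq_le hp B).trans (factorial_le_three_mul_numDerangements hcard)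
  have hsmall : ∀ B ∈ T,
      (Finset.univ.filter (fun π : Equiv.Perm (Fin n) => hitFinset ρ κ π = B)).card ≤ 1 := by
    intro B hB
    have hBn : n - B.card ≤ 1 := by
      have : B.card = n - 1 := by
        rw [hT, Finset.mem_insert, Finset.mem_singleton] at hB
        rcases hB with rfl | rfl <;> simp
      omega
    refine (card_hitFinset_eq_le hp B).trans ?_
    exact (Nat.factorial_le hBn).trans (by simp)
  have hu0 : (Finset.univ.filter
      (fun π : Equiv.Perm (Fin n) => hitFinset ρ κ π = Finset.univ)).card = 0 := by
    rw [Finset.card_eq_zero, Finset.filter_eq_empty_iff]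
    intro π _ hπ
    rcases hmiss π _ hπ with h | h <;> simp at h
  -- The full set counts 0 on the left and 3 on the right, which pays for the at most two
  -- exceptional permutations.
  rw [← Finset.add_sum_erase _ _ huniv, ← Finset.add_sum_erase _ _ huniv, hu0, hfix, zero_add]
  have hTc : T.card ≤ 2 := Finset.card_le_two
  have hterm : ∀ B ∈ S.erase Finset.univ,
      (Finset.univ.filter (fun π : Equiv.Perm (Fin n) => hitFinset ρ κ π = B)).card
        ≤ 3 * (Finset.univ.filter (fun π : Equiv.Perm (Fin n) => fixedFinset π = B)).card
          + if B ∈ T then 1 else 0 := by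
    intro B hB
    split_ifs with h
    · exact (hsmall B h).trans (by omega)
    · exact hcase B hB h
  have := Finset.sum_le_sum hterm
  rw [Finset.sum_add_distrib, ← Finset.mul_sum, Finset.sum_ite_mem, Finset.sum_const,
    smul_eq_mul, mul_one] at this
  have := Finset.card_le_card (Finset.inter_subset_right (s₁ := S.erase Finset.univ) (s₂ := T))
  omega

end Counting

/-! ### Elementary symmetric polynomials and Maclaurin's inequality. -/

section SymmetricSums

variable {n : ℕ}

/-- The elementary symmetric polynomial of degree `k` in the numbers `X i`. -/
def elemSymm (X : Fin n → ℝ) (k : ℕ) : ℝ :=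
  ∑ K ∈ Finset.univ.powersetCard k, ∏ i ∈ K, X i

theorem elemSymm_nonneg {X : Fin n → ℝ} (hX : ∀ i, 0 ≤ X i) (k : ℕ) : 0 ≤ elemSymm X k :=
  Finset.sum_nonneg fun _ _ => Finset.prod_nonneg fun i _ => hX i

theorem elemSymm_zero (X : Fin n → ℝ) : elemSymm X 0 = 1 := by
  simp [elemSymm]

/-- Double counting: pairs (L, i) with i ∈ L correspond to pairs (K, i) with i ∉ K through K = L \
{i}. -/
theorem succ_mul_elemSymm (X : Fin n → ℝ) (k : ℕ) :
    ((k : ℝ) + 1) * elemSymm X (k + 1)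
      = ∑ K ∈ (Finset.univ : Finset (Fin n)).powersetCard k, (∏ i ∈ K, X i) * ∑ i ∈ Kᶜ, X i := by
  have h1 : ((k : ℝ) + 1) * elemSymm X (k + 1)
      = ∑ L ∈ (Finset.univ : Finset (Fin n)).powersetCard (k + 1), ∑ _i ∈ L, ∏ j ∈ L, X j := by
    rw [elemSymm, Finset.mul_sum]
    refine Finset.sum_congr rfl fun L hL => ?_
    rw [Finset.sum_const, (Finset.mem_powersetCard.1 hL).2, nsmul_eq_mul]
    push_cast
    ring
  simp only [Finset.mul_sum]
  rw [h1, Finset.sum_sigma', Finset.sum_sigma']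
  refine Finset.sum_bij' (fun p _ => ⟨p.1.erase p.2, p.2⟩) (fun p _ => ⟨insert p.2 p.1, p.2⟩)
    ?_ ?_ ?_ ?_ ?_
  · rintro ⟨L, i⟩ h
    simp only [Finset.mem_sigma, Finset.mem_powersetCard, Finset.subset_univ, true_and] at h
    simp [Finset.card_erase_of_mem h.2, h.1]
  · rintro ⟨K, i⟩ h
    simp only [Finset.mem_sigma, Finset.mem_powersetCard, Finset.subset_univ, true_and,
      Finset.mem_compl] at h
    simp [Finset.card_insert_of_notMem h.2, h.1]
  · rintro ⟨L, i⟩ h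
    simp only [Finset.mem_sigma] at h
    simp [Finset.insert_erase h.2]
  · rintro ⟨K, i⟩ h
    simp only [Finset.mem_sigma, Finset.mem_compl] at h
    simp [Finset.erase_insert h.2]
  · rintro ⟨L, i⟩ h
    simp only [Finset.mem_sigma] at h
    exact (Finset.prod_erase_mul _ _ h.2).symm

/-- A j-element set K carries mass at most j, leaving at least k - j outside, so (j+1) e_{j+1} ≥
(k-j) e_j. The case j = k makes e_k a majorant of the indicator of {∑ X ≥ k}. -/
theorem choose_le_elemSymm {X : Fin n → ℝ} (h0 : ∀ i, 0 ≤ X i) (h1 : ∀ i, X i ≤ 1) {k : ℕ}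
    (hk : (k : ℝ) ≤ ∑ i, X i) {j : ℕ} (hj : j ≤ k) : (k.choose j : ℝ) ≤ elemSymm X j := by
  induction j with
  | zero => simp [elemSymm_zero]
  | succ j ih =>
    have ih := ih (by omega)
    have hstep : ((k : ℝ) - j) * elemSymm X j ≤ ((j : ℝ) + 1) * elemSymm X (j + 1) := by
      rw [succ_mul_elemSymm, elemSymm, Finset.mul_sum]
      refine Finset.sum_le_sum fun K hK => ?_
      rw [mul_comm]
      refine mul_le_mul_of_nonneg_left ?_ (Finset.prod_nonneg fun i _ => h0 i)
      have hKX : ∑ i ∈ K, X i ≤ j := by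
        have := Finset.sum_le_card_nsmul K X 1 fun i _ => h1 i
        rwa [(Finset.mem_powersetCard.1 hK).2, nsmul_eq_mul, mul_one] at this
      have := Finset.sum_add_sum_compl K X
      linarith
    have hc : (k.choose (j + 1) : ℝ) * (j + 1) = k.choose j * (k - j) := by
      have := Nat.choose_succ_right_eq k j
      rw [← Nat.cast_sub (by omega)]
      exact_mod_cast this
    have hkj : (0 : ℝ) ≤ k - j := by
      rw [sub_nonneg]
      exact_mod_cast (by omega : j ≤ k)
    have := mul_le_mul_of_nonneg_left ih hkj
    have hj0 : (0 : ℝ) < j + 1 := by positivity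
    refine le_of_mul_le_mul_left ?_ hj0
    linarith

/-- Swapping i and j matches the sets containing i with those containing j; the products change only
when K contains exactly one of the two, and then by trading one factor for the other. -/
theorem monovary_sum_prod_mem {X : Fin n → ℝ} (h0 : ∀ i, 0 ≤ X i) (k : ℕ) :
    Monovary X fun i => ∑ K ∈ (Finset.univ.powersetCard k).filter (fun K => i ∈ K),
      ∏ l ∈ K, X l := by
  intro i j hij
  by_contra! hlt
  refine absurd hij (not_lt.2 ?_)
  let σ := Equiv.swap i j
  have e : ∑ K ∈ (Finset.univ.powersetCard k).filter (fun K => i ∈ K), ∏ l ∈ K, X l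
      = ∑ K ∈ (Finset.univ.powersetCard k).filter (fun K => j ∈ K), ∏ l ∈ K, X (σ l) := by
    refine Finset.sum_equiv (Equiv.finsetCongr σ) (fun K => ?_) (fun K _ => ?_)
    · simp [σ, Finset.mem_powersetCard]
    · simp [σ]
  simp only
  rw [e]
  refine Finset.sum_le_sum fun K hK => ?_
  have hjK := (Finset.mem_filter.1 hK).2
  by_cases hiK : i ∈ K
  · have hmap : K.map σ.toEmbedding = K := by
      ext l
      simp only [Finset.mem_map_equiv, σ, Equiv.symm_swap]
      rcases eq_or_ne l i with rfl | hli
      · simp [hiK, hjK]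
      rcases eq_or_ne l j with rfl | hlj
      · simp [hiK, hjK]
      rw [Equiv.swap_apply_of_ne_of_ne hli hlj]
    conv_lhs => rw [← hmap]
    rw [Finset.prod_map]
    rfl
  · refine Finset.prod_le_prod (fun l _ => h0 l) fun l hl => ?_
    rcases eq_or_ne l j with rfl | hlj
    · simpa [σ] using hlt.le
    · have hli : l ≠ i := by
        rintro rfl
        exact hiK hl
      rw [Equiv.swap_apply_of_ne_of_ne hli hlj]

/-- Maclaurin's inequality between the elementary symmetric means and the arithmetic mean. -/
theorem elemSymm_le_choose_mul_pow {X : Fin n → ℝ} (h0 : ∀ i, 0 ≤ X i) {a : ℝ} (ha : 0 ≤ a)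
    (hs : ∑ i, X i = n * a) (k : ℕ) : elemSymm X k ≤ n.choose k * a ^ k := by
  induction k with
  | zero => simp [elemSymm_zero]
  | succ k ih =>
    rcases lt_or_ge n (k + 1) with hn | hn
    · rw [elemSymm, Finset.powersetCard_eq_empty.2 (by simpa using hn)]
      simp [Nat.choose_eq_zero_of_lt hn]
    have hn0 : (0 : ℝ) < n := by exact_mod_cast (by omega : 0 < n)
    set c : Fin n → ℝ := fun i => ∑ K ∈ (Finset.univ.powersetCard k).filter (fun K => i ∈ K),
      ∏ l ∈ K, X l with hc
    have hswap : ∀ Y : Fin n → ℝ, ∑ i, Y i * c i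
        = ∑ K ∈ (Finset.univ : Finset (Fin n)).powersetCard k, (∏ l ∈ K, X l) * ∑ i ∈ K, Y i := by
      intro Y
      simp only [hc, Finset.mul_sum, Finset.sum_filter, mul_ite, mul_zero]
      rw [Finset.sum_comm]
      refine Finset.sum_congr rfl fun K _ => ?_
      rw [← Finset.sum_filter]
      simp [mul_comm]
    have hcsum : ∑ i, c i = k * elemSymm X k := by
      have := hswap fun _ => 1
      simp only [one_mul, Finset.sum_const, nsmul_eq_mul, mul_one] at this
      rw [this, elemSymm, Finset.mul_sum]
      refine Finset.sum_congr rfl fun K hK => ?_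
      rw [(Finset.mem_powersetCard.1 hK).2, mul_comm]
    -- Chebyshev's sum inequality gives ∑ X_i c_i ≥ k a e_k; with the recursion below this yields
    -- (k+1) e_{k+1} ≤ a (n-k) e_k.
    have hcheb := (monovary_sum_prod_mem h0 k).sum_mul_sum_le_card_mul_sum
    rw [Fintype.card_fin] at hcheb
    change (∑ i, X i) * (∑ i, c i) ≤ n * ∑ i, X i * c i at hcheb
    rw [hcsum, hs, mul_assoc] at hcheb
    have hcheb := le_of_mul_le_mul_left hcheb hn0
    have hrec : ((k : ℝ) + 1) * elemSymm X (k + 1) + ∑ i, X i * c i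
        = n * a * elemSymm X k := by
      rw [succ_mul_elemSymm, hswap, ← Finset.sum_add_distrib, elemSymm, Finset.mul_sum]
      refine Finset.sum_congr rfl fun K _ => ?_
      rw [← mul_add, add_comm, Finset.sum_add_sum_compl, hs, mul_comm]
    have hch : (n.choose (k + 1) : ℝ) * (k + 1) = n.choose k * (n - k) := by
      have := Nat.choose_succ_right_eq n k
      rw [← Nat.cast_sub (by omega)]
      exact_mod_cast this
    have hnk : (0 : ℝ) ≤ n - k := by
      rw [sub_nonneg]
      exact_mod_cast (by omega : k ≤ n)
    have hih := mul_le_mul_of_nonneg_left ih (mul_nonneg ha hnk)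
    have hk0 : (0 : ℝ) < k + 1 := by positivity
    refine le_of_mul_le_mul_left ?_ hk0
    calc ((k : ℝ) + 1) * elemSymm X (k + 1)
        ≤ a * (n - k) * elemSymm X k := by linarith
      _ ≤ a * (n - k) * (n.choose k * a ^ k) := hih
      _ = (n.choose k * (n - k)) * (a * a ^ k) := by ring
      _ = ((k : ℝ) + 1) * (n.choose (k + 1) * a ^ (k + 1)) := by rw [← hch]; ring

end SymmetricSums

/-! ### Tails of sums along a random permutation. -/

section PermutationTails

variable {n : ℕ}

/-- Expand the product of row sums over all choices of a column for each row in K; a given choice is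
realised by at most (n - |K|)! permutations. -/
theorem sum_perm_prod_le {w : Fin n → Fin n → ℝ} (h0 : ∀ i j, 0 ≤ w i j) (K : Finset (Fin n)) :
    ∑ π : Equiv.Perm (Fin n), ∏ i ∈ K, w i (π i)
      ≤ (n - K.card).factorial * ∏ i ∈ K, ∑ j, w i j := by
  have e : ∀ π : Equiv.Perm (Fin n), ∏ i ∈ K, w i (π i)
      = ∏ i ∈ K.attach, w i.1 ((fun (i : Fin n) (_ : i ∈ K) => π i) i.1 i.2) := fun π =>
    (Finset.prod_attach K fun i => w i (π i)).symm
  rw [Finset.prod_sum, Finset.sum_congr rfl fun π _ => e π,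
    ← Finset.sum_fiberwise_of_maps_to (s := Finset.univ)
      (t := K.pi fun _ => (Finset.univ : Finset (Fin n)))
      (g := fun (π : Equiv.Perm (Fin n)) (i : Fin n) (_ : i ∈ K) => π i) (by simp),
    Finset.mul_sum]
  refine Finset.sum_le_sum fun τ _ => ?_
  rw [Finset.sum_congr rfl (g := fun _ => ∏ i ∈ K.attach, w i.1 (τ i.1 i.2)), Finset.sum_const,
    nsmul_eq_mul]
  · refine mul_le_mul_of_nonneg_right ?_ (Finset.prod_nonneg fun _ _ => h0 _ _)
    have := card_perm_constraints_le (ρ := id)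
      (κ := fun i => if h : i ∈ K then τ i h else i) (fun i j h => (Prod.ext_iff.1 h).1) K
    refine Nat.cast_le.2 (le_trans (Finset.card_le_card fun π => ?_) this)
    simp only [Finset.mem_filter, Finset.mem_univ, true_and, id]
    rintro rfl i hi
    simp [hi]
  · intro π hπ
    simp only [Finset.mem_filter, Finset.mem_univ, true_and] at hπ
    rw [← hπ]

/-- Markov's inequality applied to e_k of the entries met by π, followed by Maclaurin's inequality
for the row sums. -/
theorem card_le_sum_perm_le {w : Fin n → Fin n → ℝ} (h0 : ∀ i j, 0 ≤ w i j)
    (h1 : ∀ i j, w i j ≤ 1) {a : ℝ} (ha : 0 ≤ a) (hs : ∑ i, ∑ j, w i j = n * a) (k : ℕ) :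
    ((Finset.univ.filter
      (fun π : Equiv.Perm (Fin n) => (k : ℝ) ≤ ∑ i, w i (π i))).card : ℝ)
      ≤ (n - k).factorial * (n.choose k * a ^ k) := by
  calc ((Finset.univ.filter
      (fun π : Equiv.Perm (Fin n) => (k : ℝ) ≤ ∑ i, w i (π i))).card : ℝ)
      = ∑ π ∈ Finset.univ.filter
          (fun π : Equiv.Perm (Fin n) => (k : ℝ) ≤ ∑ i, w i (π i)), (1 : ℝ) := by simp
    _ ≤ ∑ π ∈ Finset.univ.filter (fun π : Equiv.Perm (Fin n) => (k : ℝ) ≤ ∑ i, w i (π i)),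
          elemSymm (fun i => w i (π i)) k := by
        refine Finset.sum_le_sum fun π hπ => ?_
        have := choose_le_elemSymm (fun i => h0 i (π i)) (fun i => h1 i (π i))
          (Finset.mem_filter.1 hπ).2 le_rfl
        simpa using this
    _ ≤ ∑ π : Equiv.Perm (Fin n), elemSymm (fun i => w i (π i)) k :=
        Finset.sum_le_sum_of_subset_of_nonneg (Finset.filter_subset _ _)
          fun π _ _ => elemSymm_nonneg (fun i => h0 i (π i)) k
    _ = ∑ K ∈ Finset.univ.powersetCard k,
          ∑ π : Equiv.Perm (Fin n), ∏ i ∈ K, w i (π i) := by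
        simp only [elemSymm]
        rw [Finset.sum_comm]
    _ ≤ ∑ K ∈ (Finset.univ : Finset (Fin n)).powersetCard k,
          ((n - k).factorial : ℝ) * ∏ i ∈ K, ∑ j, w i j := by
        refine Finset.sum_le_sum fun K hK => ?_
        have := sum_perm_prod_le h0 K
        rwa [(Finset.mem_powersetCard.1 hK).2] at this
    _ = (n - k).factorial * elemSymm (fun i => ∑ j, w i j) k := by
        rw [elemSymm, Finset.mul_sum]
    _ ≤ _ := by
        gcongr
        exact elemSymm_le_choose_mul_pow (fun i => Finset.sum_nonneg fun j _ => h0 i j) ha hs k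

theorem choose_mul_numDerangements_le (k : ℕ) :
    n.choose k * numDerangements (n - k)
      ≤ (Finset.univ.filter
          (fun π : Equiv.Perm (Fin n) => k ≤ (fixedFinset π).card)).card := by
  have h : (Finset.univ.filter
      (fun π : Equiv.Perm (Fin n) => (fixedFinset π).card = k)).card
        = n.choose k * numDerangements (n - k) := by
    rw [Finset.card_eq_sum_card_fiberwise (f := fixedFinset)
      (t := Finset.univ.powersetCard k) (fun π hπ => by
        simpa [Finset.mem_powersetCard] using hπ)]
    rw [Finset.sum_congr rfl (g := fun _ => numDerangements (n - k))]
    · simp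
    · intro K hK
      have hK := (Finset.mem_powersetCard.1 hK).2
      rw [← hK, ← card_fixedFinset_eq]
      congr 1
      ext π
      simp only [Finset.mem_filter, Finset.mem_univ, true_and, and_iff_right_iff_imp]
      rintro rfl
      rfl
  rw [← h]
  refine Finset.card_le_card fun π => ?_
  simp only [Finset.mem_filter, Finset.mem_univ, true_and]
  exact fun h => h.ge

/-- The sum of the entries `w i (π i)` met by a random permutation has tails dominated by three
times those of the number of fixed points, if the entries of `w` are at most `m` and average
`a / n`, where `m + a ≤ 1`. -/
theorem card_le_sum_perm_le_fixed {w : Fin n → Fin n → ℝ} {m a : ℝ} (h0 : ∀ i j, 0 ≤ w i j)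
    (h1 : ∀ i j, w i j ≤ m) (ha : 0 ≤ a) (hm : 0 ≤ m) (hma : m + a ≤ 1)
    (hs : ∑ i, ∑ j, w i j = n * a) (k : ℕ) :
    (Finset.univ.filter (fun π : Equiv.Perm (Fin n) => (k : ℝ) ≤ ∑ i, w i (π i))).card
      ≤ 3 * (Finset.univ.filter
          (fun π : Equiv.Perm (Fin n) => k ≤ (fixedFinset π).card)).card := by
  have htail := card_le_sum_perm_le h0 (fun i j => (h1 i j).trans (by linarith)) ha hs k
  -- Here D_{n-k} = 0 and the derangement bound is useless. The identity contributes 1 on the right.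
  -- For k > 0, if some π reaches k = n - 1, then n - 1 ≤ nm, hence na ≤ 1 and the tail bound n a^k
  -- is at most 1.
  by_cases hk : n - k = 1
  · have hfix : 1 ≤ (Finset.univ.filter
        (fun π : Equiv.Perm (Fin n) => k ≤ (fixedFinset π).card)).card := by
      refine Finset.card_pos.2 ⟨1, Finset.mem_filter.2 ⟨Finset.mem_univ _, ?_⟩⟩
      have : k ≤ n := by omega
      simpa [fixedFinset] using this
    rcases Nat.eq_zero_or_pos k with rfl | hk0
    · simp only [zero_le, Finset.filter_true]
      exact (Finset.card_filter_le _ _).trans (by omega)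
    suffices (Finset.univ.filter
        (fun π : Equiv.Perm (Fin n) => (k : ℝ) ≤ ∑ i, w i (π i))).card ≤ 1 by omega
    rcases Finset.eq_empty_or_nonempty (Finset.univ.filter
      (fun π : Equiv.Perm (Fin n) => (k : ℝ) ≤ ∑ i, w i (π i))) with he | ⟨π, hπ⟩
    · simp [he]
    have hnk : n = k + 1 := by omega
    have hπ' := (Finset.mem_filter.1 hπ).2
    have hle : ∑ i, w i (π i) ≤ n * m := by
      have := Finset.sum_le_card_nsmul Finset.univ (fun i => w i (π i)) m fun i _ => h1 i (π i)
      simpa using this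
    have hcast : (n : ℝ) = k + 1 := by exact_mod_cast hnk
    have hna : n * a ≤ 1 := by
      have : (n : ℝ) * (m + a) ≤ n * 1 := by gcongr
      linarith
    have hak : a ^ k ≤ a := pow_le_of_le_one ha (by linarith) hk0.ne'
    have hch : n.choose k = n := by
      rw [hnk]
      exact Nat.choose_succ_self_right k
    rw [hk, hch] at htail
    have : (n : ℝ) * a ^ k ≤ n * a := by gcongr
    have : ((Finset.univ.filter
        (fun π : Equiv.Perm (Fin n) => (k : ℝ) ≤ ∑ i, w i (π i))).card : ℝ) ≤ 1 := by
      refine htail.trans ?_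
      simp only [Nat.factorial_one, Nat.cast_one, one_mul]
      linarith
    exact_mod_cast this
  · have h2 : ((n - k).factorial : ℝ) * (n.choose k * a ^ k)
        ≤ (n - k).factorial * (n.choose k * 1) := by
      gcongr
      exact pow_le_one₀ ha (by linarith)
    have h3 : (Finset.univ.filter
        (fun π : Equiv.Perm (Fin n) => (k : ℝ) ≤ ∑ i, w i (π i))).card
          ≤ (n - k).factorial * n.choose k := by
      have := htail.trans h2
      rw [mul_one] at this
      exact_mod_cast this
    calc _ ≤ (n - k).factorial * n.choose k := h3
      _ ≤ (3 * numDerangements (n - k)) * n.choose k := by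
        gcongr
        exact factorial_le_three_mul_numDerangements hk
      _ = 3 * (n.choose k * numDerangements (n - k)) := by ring
      _ ≤ _ := by
        gcongr
        exact choose_mul_numDerangements_le k

end PermutationTails

/-! ### The decreasing rearrangement of the entries and the operator U. -/

section Rearrangement

variable {n : ℕ}

theorem exists_equiv_xStar (x : Matrix (Fin n) (Fin n) ℝ) :
    ∃ e : Fin (n ^ 2) ≃ Fin n × Fin n, (Antitone fun k => |x (e k).1 (e k).2|) ∧
      ∀ k : Fin (n ^ 2), xStar x ((k : ℕ) + 1) = |x (e k).1 (e k).2| := by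
  let e₀ : Fin (n ^ 2) ≃ Fin n × Fin n := (finCongr (sq n)).trans finProdFinEquiv.symm
  let σ := Tuple.sort (fun k => -|x (e₀ k).1 (e₀ k).2|)
  let e := σ.trans e₀
  have hanti : Antitone fun k => |x (e k).1 (e k).2| := fun i j hij =>
    neg_le_neg_iff.1 (Tuple.monotone_sort (fun k => -|x (e₀ k).1 (e₀ k).2|) hij)
  refine ⟨e, hanti, fun k => ?_⟩
  have hlist : ((Finset.univ : Finset (Fin n × Fin n)).val.map fun p => |x p.1 p.2|).sort (· ≥ ·)
      = List.ofFn fun k => |x (e k).1 (e k).2| := by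
    refine List.Perm.eq_of_pairwise' (Multiset.pairwise_sort _ _) ?_ ?_
    · rw [List.pairwise_ofFn]
      exact fun i j hij => hanti hij.le
    · rw [← Multiset.coe_eq_coe, Multiset.sort_eq, List.ofFn_eq_map, ← Multiset.map_coe]
      have : (Finset.univ : Finset (Fin n × Fin n)).val
          = Multiset.map e (Finset.univ : Finset (Fin (n ^ 2))).val := by
        rw [← Finset.map_univ_equiv e]
        rfl
      rw [this, Multiset.map_map]
      rfl
  unfold xStar
  rw [hlist, Nat.add_sub_cancel, List.getD_eq_getElem _ _ (by simp), List.getElem_ofFn]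

theorem xStar_nonneg (x : Matrix (Fin n) (Fin n) ℝ) (k : ℕ) : 0 ≤ xStar x k := by
  unfold xStar
  rcases lt_or_ge (k - 1) (((Finset.univ : Finset (Fin n × Fin n)).val.map
    fun p => |x p.1 p.2|).sort (· ≥ ·)).length with h | h
  · rw [List.getD_eq_getElem _ _ h]
    have := List.getElem_mem h
    rw [Multiset.mem_sort, Multiset.mem_map] at this
    obtain ⟨p, -, hp⟩ := this
    rw [← hp]
    exact abs_nonneg _
  · rw [List.getD_eq_default _ _ h]

theorem xStar_le_of_card_lt {y : Matrix (Fin n) (Fin n) ℝ} {k : ℕ} (hk : k < n ^ 2) {s : ℝ}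
    (h : (Finset.univ.filter (fun p : Fin n × Fin n => s < |y p.1 p.2|)).card ≤ k) :
    xStar y (k + 1) ≤ s := by
  obtain ⟨e, hanti, he⟩ := exists_equiv_xStar y
  by_contra! hc
  rw [he ⟨k, hk⟩] at hc
  have : k + 1 ≤ (Finset.univ.filter (fun p : Fin n × Fin n => s < |y p.1 p.2|)).card := by
    rw [← Fin.card_Iic (⟨k, hk⟩ : Fin (n ^ 2))]
    refine Finset.card_le_card_of_injOn e (fun j hj => ?_) e.injective.injOn
    simp only [Finset.coe_Iic, Set.mem_Iic] at hj
    simpa using hc.trans_le (hanti hj)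
  omega

theorem UFun_nonneg (x : Matrix (Fin n) (Fin n) ℝ) (t : ℝ) : 0 ≤ UFun x t :=
  Finset.sum_nonneg fun _ _ => Set.indicator_nonneg (fun _ _ => xStar_nonneg _ _) _

theorem eq_ceil_of_mem_Ioo (hn : 0 < n) {k : ℕ} {t : ℝ}
    (ht : t ∈ Set.Ioo (((k : ℝ) - 1) / (n : ℝ)) ((k : ℝ) / (n : ℝ))) : (k : ℤ) = ⌈t * n⌉ := by
  have hn' : (0 : ℝ) < n := by exact_mod_cast hn
  rw [Set.mem_Ioo, div_lt_iff₀ hn', lt_div_iff₀ hn'] at ht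
  rw [eq_comm, Int.ceil_eq_iff]
  push_cast
  exact ⟨ht.1, ht.2.le⟩

theorem UFun_le (hn : 0 < n) {x : Matrix (Fin n) (Fin n) ℝ} {c : ℝ} (hc : 0 ≤ c)
    (h : ∀ k ∈ Finset.Icc 1 n, xStar x k ≤ c) (t : ℝ) : UFun x t ≤ c := by
  by_cases h0 : UFun x t = 0
  · rwa [h0]
  obtain ⟨k, hk, hk'⟩ := Finset.exists_ne_zero_of_sum_ne_zero h0
  have hm := Set.mem_of_indicator_ne_zero hk'
  rw [UFun, Finset.sum_eq_single_of_mem k hk, Set.indicator_of_mem hm]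
  · exact h k hk
  · intro j _ hjk
    refine Set.indicator_of_notMem (fun hj => hjk ?_) _
    exact_mod_cast (eq_ceil_of_mem_Ioo hn hj).trans (eq_ceil_of_mem_Ioo hn hm).symm

/-- Only almost everywhere, because `UFun` vanishes at the grid points k/n. -/
theorem ae_le_UFun (hn : 0 < n) {x : Matrix (Fin n) (Fin n) ℝ} {c : ℝ}
    (h : ∀ k ∈ Finset.Icc 1 n, c ≤ xStar x k) : ∀ᵐ t ∂unitMeasure, c ≤ UFun x t := by
  have hn' : (0 : ℝ) < n := by exact_mod_cast hn
  have hcount : ∀ᵐ t ∂unitMeasure, t ∉ Set.range fun k : ℤ => (k : ℝ) / n := by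
    refine ae_restrict_of_ae ?_
    exact (Set.countable_range _).ae_notMem volume
  filter_upwards [hcount, ae_restrict_mem measurableSet_Icc] with t ht ht'
  have hne : ∀ k : ℤ, t * n ≠ k := fun k hk => ht ⟨k, by simp only [← hk]; field_simp⟩
  have hlt : 0 < t * n := lt_of_le_of_ne (mul_nonneg ht'.1 hn'.le) (by
    have := hne 0
    push_cast at this
    exact this.symm)
  set k := ⌈t * n⌉₊ with hk
  have hk1 : 1 ≤ k := Nat.one_le_iff_ne_zero.2 (Nat.ceil_pos.2 hlt).ne'
  have hkn : k ≤ n := by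
    refine Nat.ceil_le.2 ?_
    nlinarith [ht'.2]
  have hmem : k ∈ Finset.Icc 1 n := Finset.mem_Icc.2 ⟨hk1, hkn⟩
  have hIoo : t ∈ Set.Ioo (((k : ℝ) - 1) / (n : ℝ)) ((k : ℝ) / (n : ℝ)) := by
    rw [Set.mem_Ioo, div_lt_iff₀ hn', lt_div_iff₀ hn']
    refine ⟨?_, lt_of_le_of_ne (Nat.le_ceil _) (by exact_mod_cast hne k)⟩
    have := Nat.ceil_lt_add_one hlt.le
    linarith
  refine (h k hmem).trans ?_
  have := Finset.single_le_sum (f := fun k : ℕ => (Set.Ioo (((k : ℝ) - 1) / (n : ℝ))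
    ((k : ℝ) / (n : ℝ))).indicator (fun _ => xStar x k) t)
    (fun k _ => Set.indicator_nonneg (fun _ _ => xStar_nonneg _ _) _) hmem
  simp only [Set.indicator_of_mem hIoo] at this
  exact this

theorem RISpace.norm_UOp_le_one (E : RISpace) (hn : 0 < n) :
    E.norm (UOp E (1 : Matrix (Fin n) (Fin n) ℝ)) ≤ 1 := by
  rw [UOp_eq_ofBounded]
  refine le_of_le_of_eq ?_ (E.norm_ofBounded_const zero_le_one)
  refine E.norm_le_of_abs_le _ _ _ _ (Filter.Eventually.of_forall fun t => ?_)
  rw [abs_of_nonneg (UFun_nonneg _ _), abs_one]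
  refine UFun_le hn zero_le_one (fun k hk => ?_) t
  rw [Finset.mem_Icc] at hk
  obtain ⟨j, rfl⟩ : ∃ j, k = j + 1 := ⟨k - 1, by omega⟩
  refine xStar_le_of_card_lt (by nlinarith) ?_
  rw [Finset.filter_eq_empty_iff.2]
  · simp
  · intro p _
    rw [Matrix.one_apply]
    split_ifs <;> simp

theorem RISpace.norm_UOp_mono (E : RISpace) {x y : Matrix (Fin n) (Fin n) ℝ}
    (h : ∀ k ∈ Finset.Icc 1 n, xStar x k ≤ xStar y k) :
    E.norm (UOp E x) ≤ E.norm (UOp E y) := by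
  rw [UOp_eq_ofBounded, UOp_eq_ofBounded]
  refine E.norm_le_of_abs_le _ _ _ _ (Filter.Eventually.of_forall fun t => ?_)
  rw [abs_of_nonneg (UFun_nonneg _ _), abs_of_nonneg (UFun_nonneg _ _)]
  exact Finset.sum_le_sum fun k hk => Set.indicator_le_indicator (h k hk)

theorem RISpace.le_norm_UOp (E : RISpace) (hn : 0 < n) {x : Matrix (Fin n) (Fin n) ℝ} {c : ℝ}
    (hc : 0 ≤ c) (h : ∀ k ∈ Finset.Icc 1 n, c ≤ xStar x k) : c ≤ E.norm (UOp E x) := by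
  rw [UOp_eq_ofBounded]
  refine le_of_eq_of_le (E.norm_ofBounded_const hc).symm ?_
  refine E.norm_le_of_abs_le _ _ _ _ ?_
  filter_upwards [ae_le_UFun hn h] with t ht
  rw [abs_of_nonneg hc]
  exact ht.trans (le_abs_self _)

end Rearrangement

/-! ### Norm estimates for T_q. -/

section Operators

variable {n : ℕ}

theorem RISpace.norm_Tq_add_le (E : RISpace) (ℓ : Equiv.Perm (Fin n) ≃ Fin n.factorial) {q : ℝ}
    (hq : 1 < q) (x y : Matrix (Fin n) (Fin n) ℝ) :
    E.norm (Tq E ℓ q (x + y)) ≤ E.norm (Tq E ℓ q x) + E.norm (Tq E ℓ q y) := by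
  rw [Tq_eq_step, Tq_eq_step, Tq_eq_step]
  refine le_trans (E.norm_step_mono ?_) (le_of_eq_of_le
    (congrArg E.norm (E.step_add _ _)) (E.norm_add_le _ _))
  intro i
  rw [abs_of_nonneg (by positivity)]
  refine le_trans ?_ (le_abs_self _)
  exact Real.Lp_add_le Finset.univ (fun j => x j (ℓ.symm i j)) (fun j => y j (ℓ.symm i j)) hq.le

theorem sum_diagonal_rpow (v : Fin n → ℝ) {q : ℝ} (hq : 0 < q) (π : Equiv.Perm (Fin n)) :
    ∑ j, |Matrix.diagonal v j (π j)| ^ q = ∑ i ∈ fixedFinset π, |v i| ^ q := by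
  rw [fixedFinset, Finset.sum_filter]
  refine Finset.sum_congr rfl fun j _ => ?_
  split_ifs with h
  · rw [h, Matrix.diagonal_apply_eq]
  · rw [Matrix.diagonal_apply_ne' _ h, abs_zero, Real.zero_rpow hq.ne']

theorem sum_rpow_eq_sum_hitFinset {ρ κ : Fin n → Fin n}
    (hp : Function.Injective fun i => (ρ i, κ i)) {x : Matrix (Fin n) (Fin n) ℝ}
    (hx : ∀ p : Fin n × Fin n, (p ∉ Set.range fun i => (ρ i, κ i)) → x p.1 p.2 = 0)
    {q : ℝ} (hq : 0 < q) (π : Equiv.Perm (Fin n)) :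
    ∑ j, |x j (π j)| ^ q = ∑ i ∈ hitFinset ρ κ π, |x (ρ i) (κ i)| ^ q := by
  symm
  have hmem : ∀ i, i ∈ hitFinset ρ κ π ↔ π (ρ i) = κ i := fun i => by simp [hitFinset]
  refine Finset.sum_of_injOn ρ (fun i hi j hj hij => hp (Prod.ext hij ?_)) (by simp) ?_ ?_
  · simp only
    rw [← (hmem i).1 hi, ← (hmem j).1 hj, hij]
  · intro j _ hj
    rw [hx (j, π j), abs_zero, Real.zero_rpow hq.ne']
    rintro ⟨i, hi⟩
    obtain ⟨h1, h2⟩ := Prod.ext_iff.1 hi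
    simp only at h1 h2
    refine hj ⟨i, ?_, h1⟩
    exact (hmem i).2 (by rw [h1, h2])
  · intro i hi
    rw [(hmem i).1 hi]

/-- A matrix supported on `n` positions is comparable to the diagonal matrix with the same
entries. -/
theorem RISpace.norm_Tq_le_diagonal (E : RISpace) (ℓ : Equiv.Perm (Fin n) ≃ Fin n.factorial)
    {q : ℝ} (hq : 0 < q) {ρ κ : Fin n → Fin n} (hp : Function.Injective fun i => (ρ i, κ i))
    {x : Matrix (Fin n) (Fin n) ℝ}
    (hx : ∀ p : Fin n × Fin n, (p ∉ Set.range fun i => (ρ i, κ i)) → x p.1 p.2 = 0) :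
    E.norm (Tq E ℓ q x)
      ≤ 3 * E.norm (Tq E ℓ q (Matrix.diagonal fun i => x (ρ i) (κ i))) := by
  classical
  rw [Tq_eq_step, Tq_eq_step]
  refine E.norm_step_le_three_mul fun s _ => ?_
  simp only [sum_diagonal_rpow _ hq, sum_rpow_eq_sum_hitFinset hp hx hq]
  let S : Finset (Finset (Fin n)) := Finset.univ.filter fun B =>
    s < |(∑ i ∈ B, |x (ρ i) (κ i)| ^ q) ^ (1 / q)|
  have hS : ∀ A ∈ S, ∀ B, A ⊆ B → B ∈ S := by
    intro A hA B hAB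
    simp only [S, Finset.mem_filter, Finset.mem_univ, true_and] at hA ⊢
    refine hA.trans_le ?_
    rw [abs_of_nonneg (by positivity), abs_of_nonneg (by positivity)]
    gcongr
  have h := card_hitFinset_mem_le hp S hS
  have h1 : ∀ f : Equiv.Perm (Fin n) → Finset (Fin n),
      (Finset.univ.filter fun i : Fin n.factorial =>
        s < |(∑ j ∈ f (ℓ.symm i), |x (ρ j) (κ j)| ^ q) ^ (1 / q)|).card
        = (Finset.univ.filter fun π => f π ∈ S).card := fun f =>
    Finset.card_equiv ℓ.symm (by simp [S])
  rw [h1, h1]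
  exact h

/-- After scaling by M + A, the integer part of ∑ w_{i,π(i)} is compared with the number of fixed
points, which produces 3‖T_q 1‖; the discarded fractional part produces the summand 1. -/
theorem RISpace.norm_Tq_le_of_bounded (E : RISpace) (ℓ : Equiv.Perm (Fin n) ≃ Fin n.factorial)
    {q : ℝ} (hq : 1 < q) {z : Matrix (Fin n) (Fin n) ℝ} {M A : ℝ} (hA : 0 ≤ A)
    (hM0 : 0 ≤ M) (hM : ∀ i j, |z i j| ≤ M) (hs : ∑ i, ∑ j, |z i j| ^ q = n * A ^ q) :
    E.norm (Tq E ℓ q z)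
      ≤ (M + A) * (1 + 3 * E.norm (Tq E ℓ q (1 : Matrix (Fin n) (Fin n) ℝ))) := by
  have hq0 : 0 < q := by linarith
  rw [Tq_eq_step, Tq_eq_step]
  set B := M + A with hB
  have hB0 : 0 ≤ B := by positivity
  let w : Fin n → Fin n → ℝ := fun i j => (|z i j| / B) ^ q
  have hw0 : ∀ i j, 0 ≤ w i j := fun i j => by positivity
  let f : Fin n.factorial → ℝ := fun i => (⌊∑ j, w j (ℓ.symm i j)⌋₊ : ℝ) ^ (1 / q)
  have hdom : E.norm (E.step fun i => (∑ j : Fin n, |z j (ℓ.symm i j)| ^ q) ^ (1 / q))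
      ≤ E.norm (E.step (B • ((fun _ => (1 : ℝ)) + f))) := by
    refine E.norm_step_mono fun i => ?_
    rw [abs_of_nonneg (by positivity)]
    refine le_trans ?_ (le_abs_self _)
    have hz : ∀ j k, |z j k| ^ q = B ^ q * w j k := by
      intro j k
      simp only [w]
      rw [Real.div_rpow (abs_nonneg _) hB0]
      rcases hB0.eq_or_lt with h | h
      · have : |z j k| = 0 := le_antisymm ((hM j k).trans (by linarith)) (abs_nonneg _)
        rw [this, ← h, Real.zero_rpow hq0.ne', zero_mul]
      · have : B ^ q ≠ 0 := (Real.rpow_pos_of_pos h q).ne'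
        field_simp
    have hS0 : 0 ≤ ∑ j, w j (ℓ.symm i j) := Finset.sum_nonneg fun j _ => hw0 _ _
    simp only [hz, ← Finset.mul_sum, Pi.smul_apply, Pi.add_apply, smul_eq_mul]
    rw [Real.mul_rpow (by positivity) hS0, ← Real.rpow_mul hB0, mul_one_div_cancel hq0.ne',
      Real.rpow_one]
    refine mul_le_mul_of_nonneg_left ?_ hB0
    calc (∑ j, w j (ℓ.symm i j)) ^ (1 / q)
        ≤ (1 + (⌊∑ j, w j (ℓ.symm i j)⌋₊ : ℝ)) ^ (1 / q) := by
          refine Real.rpow_le_rpow hS0 ?_ (by positivity)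
          rw [add_comm]
          exact (Nat.lt_floor_add_one _).le
      _ ≤ 1 ^ (1 / q) + (⌊∑ j, w j (ℓ.symm i j)⌋₊ : ℝ) ^ (1 / q) := by
          refine Real.rpow_add_le_add_rpow zero_le_one (by positivity) (by positivity) ?_
          rw [div_le_one hq0]
          exact hq.le
      _ = 1 + f i := by rw [Real.one_rpow]
  have hf : E.norm (E.step f) ≤ 3 * E.norm (E.step fun i =>
      (∑ j : Fin n, |(1 : Matrix (Fin n) (Fin n) ℝ) j (ℓ.symm i j)| ^ q) ^ (1 / q)) := by
    refine E.norm_step_le_three_mul fun s hs0 => ?_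
    simp only [← Matrix.diagonal_one, sum_diagonal_rpow _ hq0, abs_one, Real.one_rpow,
      Finset.sum_const, nsmul_eq_mul, mul_one]
    -- For an integer N, the condition s < N^(1/q) means N > s^q, that is N ≥ ⌊s^q⌋ + 1.
    set k := ⌊s ^ q⌋₊ + 1 with hk
    have hiff : ∀ N : ℕ, s < |(N : ℝ) ^ (1 / q)| ↔ k ≤ N := by
      intro N
      rw [abs_of_nonneg (by positivity), one_div,
        Real.lt_rpow_inv_iff_of_pos hs0 (by positivity) hq0, hk, Nat.succ_le_iff,
        Nat.floor_lt (by positivity)]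
    simp only [f, hiff]
    have hle : ∀ i j, w i j ≤ (M / B) ^ q := fun i j => by
      simp only [w]
      gcongr
      exact hM i j
    have hwsum : ∑ i, ∑ j, w i j = n * (A / B) ^ q := by
      simp only [w, Real.div_rpow (abs_nonneg _) hB0, ← Finset.sum_div]
      rw [hs, Real.div_rpow hA hB0, mul_div_assoc]
    -- Since q > 1, t^q ≤ t on [0,1]; hence (M/B)^q + (A/B)^q ≤ (M + A)/B ≤ 1.
    have hle1 : ∀ c, 0 ≤ c → c ≤ B → (c / B) ^ q ≤ c / B := by
      intro c hc hcB
      have := Real.rpow_le_rpow_of_exponent_ge' (div_nonneg hc hB0)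
        (div_le_one_of_le₀ hcB hB0) zero_le_one hq.le
      rwa [Real.rpow_one] at this
    have hma : (M / B) ^ q + (A / B) ^ q ≤ 1 := by
      refine (add_le_add (hle1 M hM0 (by linarith)) (hle1 A hA (by linarith))).trans ?_
      rw [← add_div]
      exact div_self_le_one _
    have h := card_le_sum_perm_le_fixed hw0 hle (by positivity) (by positivity) hma hwsum k
    have e1 : (Finset.univ.filter fun i : Fin n.factorial =>
        k ≤ ⌊∑ j, w j (ℓ.symm i j)⌋₊).card
        = (Finset.univ.filter
          (fun π : Equiv.Perm (Fin n) => (k : ℝ) ≤ ∑ i, w i (π i))).card := by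
      refine Finset.card_equiv ℓ.symm fun i => ?_
      simp only [Finset.mem_filter, Finset.mem_univ, true_and]
      exact Nat.le_floor_iff (Finset.sum_nonneg fun j _ => hw0 _ _)
    have e2 : (Finset.univ.filter fun i : Fin n.factorial =>
        k ≤ (fixedFinset (ℓ.symm i)).card).card
        = (Finset.univ.filter
          (fun π : Equiv.Perm (Fin n) => k ≤ (fixedFinset π).card)).card :=
      Finset.card_equiv ℓ.symm (by simp)
    rw [e1, e2]
    exact h
  rw [E.step_smul, E.norm_smul, abs_of_nonneg hB0, E.step_add] at hdom
  refine hdom.trans (mul_le_mul_of_nonneg_left ?_ hB0)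
  exact (E.norm_add_le _ _).trans (add_le_add E.norm_step_one_le hf)

end Operators

/-! ### The splitting of x and the final estimate. -/

theorem theorem7 (E : RISpace) (C q : ℝ) (hC : 1 < C) (hq : 1 < q)
    (n : ℕ) (hn : 0 < n) (ℓ : Equiv.Perm (Fin n) ≃ Fin n.factorial)
    (hdiag : ∀ y : Matrix (Fin n) (Fin n) ℝ, y.IsDiag →
      E.norm (Tq E ℓ q y) ≤ C * E.norm (UOp E y))
    (x : Matrix (Fin n) (Fin n) ℝ) :
    E.norm (Tq E ℓ q x) ≤ 7 * C * (E.norm (UOp E x)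
      + ((1 / (n : ℝ)) * ∑ k ∈ Finset.Icc (n + 1) (n ^ 2), xStar x k ^ q) ^ (1 / q)) := by
  have hq0 : 0 < q := by linarith
  have hn' : (0 : ℝ) < n := by exact_mod_cast hn
  have hnn : n ≤ n ^ 2 := Nat.le_self_pow two_ne_zero n
  obtain ⟨e, hanti, he⟩ := exists_equiv_xStar x
  let p : Fin n → Fin n × Fin n := fun i => e (Fin.castLE hnn i)
  have hp : Function.Injective fun i => ((p i).1, (p i).2) := fun i j hij =>
    Fin.castLE_injective hnn (e.injective hij)
  let y : Matrix (Fin n) (Fin n) ℝ := fun i j => if (e.symm (i, j) : ℕ) < n then x i j else 0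
  let z : Matrix (Fin n) (Fin n) ℝ := fun i j => if (e.symm (i, j) : ℕ) < n then 0 else x i j
  have hyz : x = y + z := by
    ext i j
    change x i j = (if _ then _ else _) + (if _ then _ else _)
    split_ifs <;> simp
  set M := xStar x n with hM
  set A := ((1 / (n : ℝ)) * ∑ k ∈ Finset.Icc (n + 1) (n ^ 2), xStar x k ^ q) ^ (1 / q) with hA
  have hsum0 : 0 ≤ ∑ k ∈ Finset.Icc (n + 1) (n ^ 2), xStar x k ^ q :=
    Finset.sum_nonneg fun k _ => Real.rpow_nonneg (xStar_nonneg x k) q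
  have hA0 : 0 ≤ A := by positivity
  have hxy : ∀ i, y (p i).1 (p i).2 = x (p i).1 (p i).2 := fun i => by simp [y, p]
  have hstar : ∀ k (hk : k < n ^ 2), xStar x (k + 1) = |x (e ⟨k, hk⟩).1 (e ⟨k, hk⟩).2| :=
    fun k hk => he ⟨k, hk⟩
  have hMe : M = |x (e ⟨n - 1, by omega⟩).1 (e ⟨n - 1, by omega⟩).2| := by
    rw [hM, ← hstar, Nat.sub_add_cancel hn]
  have hMU : M ≤ E.norm (UOp E x) := by
    refine E.le_norm_UOp hn (xStar_nonneg _ _) fun k hk => ?_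
    rw [Finset.mem_Icc] at hk
    obtain ⟨j, rfl⟩ : ∃ j, k = j + 1 := ⟨k - 1, by omega⟩
    rw [hMe, hstar j (by omega)]
    exact hanti (Fin.mk_le_mk.2 (by omega))
  have hy : E.norm (Tq E ℓ q y) ≤ 3 * (C * E.norm (UOp E x)) := by
    refine (E.norm_Tq_le_diagonal ℓ hq0 hp ?_).trans ?_
    · intro r hr
      refine if_neg fun hlt => hr ⟨⟨_, hlt⟩, ?_⟩
      simp [p]
    · refine mul_le_mul_of_nonneg_left ((hdiag _ (Matrix.isDiag_diagonal _)).trans ?_) (by norm_num)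
      refine mul_le_mul_of_nonneg_left (E.norm_UOp_mono fun k hk => ?_) (by linarith)
      rw [Finset.mem_Icc] at hk
      obtain ⟨j, rfl⟩ : ∃ j, k = j + 1 := ⟨k - 1, by omega⟩
      -- A diagonal entry exceeding x_{j+1}^* must have index below j in the decreasing enumeration,
      -- so there are at most j of them.
      refine xStar_le_of_card_lt (by omega) ?_
      simp only [hxy]
      have hj : j < n := by omega
      have hcard : (Finset.Iio (⟨j, hj⟩ : Fin n)).card = j := by rw [Fin.card_Iio]
      refine le_of_le_of_eq (Finset.card_le_card_of_injOn Prod.fst (fun r hr => ?_) ?_) hcard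
      · replace hr := (Finset.mem_filter.1 (Finset.mem_coe.1 hr)).2
        rw [Matrix.diagonal_apply] at hr
        split_ifs at hr with h
        · simp only [Finset.coe_Iio, Set.mem_Iio]
          by_contra! hc
          rw [hstar j (by omega)] at hr
          exact absurd hr (not_lt.2 (hanti (Fin.mk_le_mk.2 (Fin.le_def.1 hc))))
        · rw [abs_zero] at hr
          exact absurd hr (not_lt.2 (xStar_nonneg _ _))
      · have hdiagpos : ∀ r : Fin n × Fin n, xStar x (j + 1)
            < |Matrix.diagonal (fun i => x (p i).1 (p i).2) r.1 r.2| → r.1 = r.2 := by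
          intro r hr
          by_contra hne
          rw [Matrix.diagonal_apply_ne _ hne, abs_zero] at hr
          exact absurd hr (not_lt.2 (xStar_nonneg _ _))
        intro r hr r' hr' hrr
        simp only [Finset.coe_filter, Finset.mem_univ, true_and, Set.mem_ofPred_eq] at hr hr'
        exact Prod.ext hrr ((hdiagpos r hr).symm.trans (hrr.trans (hdiagpos r' hr')))
  have hz : E.norm (Tq E ℓ q z)
      ≤ (M + A) * (1 + 3 * E.norm (Tq E ℓ q (1 : Matrix (Fin n) (Fin n) ℝ))) := by
    refine E.norm_Tq_le_of_bounded ℓ hq hA0 (xStar_nonneg _ _) (fun i j => ?_) ?_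
    · simp only [z]
      split_ifs with h
      · rw [abs_zero]
        exact xStar_nonneg _ _
      · rw [hMe]
        have := hanti (show (⟨n - 1, by omega⟩ : Fin (n ^ 2)) ≤ e.symm (i, j) from
          Fin.le_def.2 (by simp only; omega))
        simpa using this
    · rw [hA, ← Real.rpow_mul (by positivity), one_div_mul_cancel hq0.ne', Real.rpow_one,
        ← mul_assoc, mul_one_div_cancel hn'.ne', one_mul,
        ← Fintype.sum_prod_type' (fun i j => |z i j| ^ q), ← Equiv.sum_comp e]
      have hterm : ∀ k : Fin (n ^ 2), |z (e k).1 (e k).2| ^ q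
          = if n ≤ (k : ℕ) then xStar x ((k : ℕ) + 1) ^ q else 0 := by
        intro k
        rw [he]
        simp only [z, Prod.mk.eta, Equiv.symm_apply_apply]
        split_ifs with h1 h2 h2
        · omega
        · rw [abs_zero, Real.zero_rpow hq0.ne']
        · rfl
        · omega
      rw [Finset.sum_congr rfl fun k _ => hterm k,
        Fin.sum_univ_eq_sum_range (fun k => if n ≤ k then xStar x (k + 1) ^ q else 0),
        ← Finset.sum_filter]
      refine Finset.sum_bij' (fun k _ => k + 1) (fun k _ => k - 1) ?_ ?_ ?_ ?_ ?_
      · intro k hk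
        simp only [Finset.mem_filter, Finset.mem_range, Finset.mem_Icc] at hk ⊢
        omega
      · intro k hk
        simp only [Finset.mem_filter, Finset.mem_range, Finset.mem_Icc] at hk ⊢
        omega
      · intro k _
        simp
      · intro k hk
        simp only [Finset.mem_Icc] at hk
        omega
      · intro k _
        rfl
  have hone : E.norm (Tq E ℓ q (1 : Matrix (Fin n) (Fin n) ℝ)) ≤ C := by
    refine (hdiag 1 Matrix.isDiag_one).trans ?_
    have := mul_le_mul_of_nonneg_left (E.norm_UOp_le_one hn) (by linarith : (0 : ℝ) ≤ C)
    linarith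
  have hM0 : 0 ≤ M := xStar_nonneg _ _
  -- Uses M ≤ ‖Ux‖ and 1 + 3C ≤ 4C, the latter from C > 1.
  have hz' : E.norm (Tq E ℓ q z) ≤ (E.norm (UOp E x) + A) * (4 * C) :=
    hz.trans (mul_le_mul (by linarith) (by linarith)
      (by linarith [E.norm_nonneg (Tq E ℓ q (1 : Matrix (Fin n) (Fin n) ℝ))])
      (by linarith))
  have hCA : 0 ≤ C * A := mul_nonneg (by linarith) hA0
  have htri : E.norm (Tq E ℓ q x) ≤ E.norm (Tq E ℓ q y) + E.norm (Tq E ℓ q z) := by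
    conv_lhs => rw [hyz]
    exact E.norm_Tq_add_le ℓ hq y z
  linarith
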